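/- Consider a network with finite agent set $\mathcal N$ and a combination matrix $A=[a_{\ell k}]$ with $a_{\ell k}\ge 0$ and $\sum_{\ell} a_{\ell k}=1$ for all $k$; there is a link from $\ell$ to $k$ if $a_{\ell k}>0$. The network is weakly connected: $\mathcal N$ is partitioned into sending sub-networks $\mathcal N_1,\dots,\mathcal N_S$, with union $\mathcal S$, and receiving sub-networks $\mathcal N_{S+1},\dots,\mathcal N_{S+R}$, with union $\mathcal R$, such that (i) within each sub-network, any two distinct agents are joined in both directions by directed paths of links that stay in the sub-network; (ii) there are no links between different sending sub-networks and no links from $\mathcal R$ to $\mathcal S$; (iii) each receiving sub-network receives a link from at least one agent of each sending sub-network. Let $A_{\mathcal N_s}$, $A_{\mathcal S\mathcal R}$ and $A_{\mathcal R}$ be the blocks of $A$ with rows and columns in $\mathcal N_s\times\mathcal N_s$, $\mathcal S\times\mathcal R$ and $\mathcal R\times\mathcal R$. Let $p^{(s)}$ be the Perron eigenvector of $A_{\mathcal N_s}$ ($A_{\mathcal N_s}p^{(s)}=p^{(s)}$, positive entries of sum $1$), let $E=\mathsf{blockdiag}\{p^{(1)}\mathbb 1^\top,\dots,p^{(S)}\mathbb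 1^\top\}$, and let $\Omega=[\omega_{\ell k}]=E\,A_{\mathcal S\mathcal R}(I-A_{\mathcal R})^{-1}$, with rows $\ell\in\mathcal S$ and columns $k\in\mathcal R$. Let $\Theta$ be a finite set of hypotheses. Each agent $k$ has a data space $\mathcal X_k$ with a reference measure, a true probability density $f_k$ and likelihoods $L_k(\cdot|\theta)$, $\theta\in\Theta$, which are probability densities with respect to the reference measure (pdfs or pmfs, for instance). At times $i=1,2,\dots$ agent $k$ observes a random variable $\xi_{k,i}\in\mathcal X_k$ with density $f_k$; the collections $(\xi_{k,i})_{k\in\mathcal N}$ are independent over $i$, but the data may be dependent across agents. From deterministic initial beliefs $\mu_{k,0}$ (probability vectors on $\Theta$), the agents run the log-belief diffusion rule, for $i\ge 1$, $$\psi_{k,i}(\theta)=\frac{\mu_{k,i-1}(\theta)L_k(\xi_{k,i}|\theta)}{\sum_{\theta'\in\Theta}\mu_{k,i-1}(\theta')L_k(\xi_{k,i}|\theta')},\qquad \mu_{k,i}(\theta)=\frac{\exp\{\sum_{\ell}a_{\ell k}\log\psi_{\ell,i}(\theta)\}}{\sum_{\theta'\in\Theta}\exp\{\sum_{\ell}a_{\ell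 k}\log\psi_{\ell,i}(\theta')\}}.$$ Assume that all Kullback--Leibler divergences $D[f_k\|L_k(\theta)]=\mathbb E_{f_k}\big[\log\frac{f_k(\xi)}{L_k(\xi|\theta)}\big]$, $k\in\mathcal N$, $\theta\in\Theta$, are finite, and that $\mu_{k,0}(\theta)>0$ for all $k\in\mathcal N$, $\theta\in\Theta$. Let $k\in\mathcal R$ and suppose that $\mathscr D_k(\theta)=\sum_{\ell\in\mathcal S}\omega_{\ell k}D[f_\ell\|L_\ell(\theta)]$ has a unique minimizer $\theta^\star_k$ over $\Theta$. Then, almost surely, $\lim_{i\to\infty}\mu_{k,i}(\theta^\star_k)=1$. Moreover, for every $\theta\ne\theta^\star_k$, almost surely, $$\lim_{i\to\infty}\frac{\log\mu_{k,i}(\theta)}{i}=\mathscr D_k(\theta^\star_k)-\mathscr D_k(\theta).$$ -/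

import Mathlib

open MeasureTheory ProbabilityTheory Filter Topology

namespace SocialLearning

noncomputable section

/-! ### Weakly connected networks

The agents form a finite type `V`. A map `comp : V → Fin S ⊕ Fin R` assigns to every agent its
sub-network: `Sum.inl s` is the `s`-th sending sub-network and `Sum.inr r` is the `r`-th receiving
sub-network. The entry `A ℓ k` is the weight that agent `k` gives to what it receives from agent
`ℓ`; there is a link from `ℓ` to `k` when `0 < A ℓ k`. -/

section Network

variable {V : Type*} {S R : ℕ}

/-- The set of all agents of the sending part. -/
abbrev Sending (comp : V → Fin S ⊕ Fin R) : Type _ := {ℓ : V // (comp ℓ).isLeft = true}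

/-- The set of all agents of the receiving part. -/
abbrev Receiving (comp : V → Fin S ⊕ Fin R) : Type _ := {k : V // (comp k).isRight = true}

/-- The block of the combination matrix that belongs to the sub-network `c`. -/
def block (A : Matrix V V ℝ) (comp : V → Fin S ⊕ Fin R) (c : Fin S ⊕ Fin R) :
    Matrix {ℓ : V // comp ℓ = c} {ℓ : V // comp ℓ = c} ℝ :=
  A.submatrix Subtype.val Subtype.val

/-- Any two distinct agents are linked, in both directions, by a path of positive weights. -/
def PathConnected {n : Type*} (M : Matrix n n ℝ) : Prop :=
  ∀ i j : n, Relation.ReflTransGen (fun a b => 0 < M a b) i j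

/-- `A` is the (left-stochastic) combination matrix of a weakly connected network whose
sub-networks are given by `comp`. -/
structure IsWeaklyConnected [Fintype V] (A : Matrix V V ℝ) (comp : V → Fin S ⊕ Fin R) :
    Prop where
  nonneg : ∀ ℓ k, 0 ≤ A ℓ k
  sum_col : ∀ k, ∑ ℓ, A ℓ k = 1
  sending_connected : ∀ s : Fin S, PathConnected (block A comp (Sum.inl s))
  receiving_connected : ∀ r : Fin R, PathConnected (block A comp (Sum.inr r))
  /-- agents of different sending sub-networks do not communicate -/
  sending_separate : ∀ ℓ k (s s' : Fin S),
    comp ℓ = Sum.inl s → comp k = Sum.inl s' → s ≠ s' → A ℓ k = 0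
  /-- no communication from the receiving part to the sending part -/
  no_feedback : ∀ ℓ k (r : Fin R) (s : Fin S),
    comp ℓ = Sum.inr r → comp k = Sum.inl s → A ℓ k = 0
  /-- each receiving sub-network gets data from an agent of each sending sub-network -/
  reached : ∀ (s : Fin S) (r : Fin R),
    ∃ ℓ k, comp ℓ = Sum.inl s ∧ comp k = Sum.inr r ∧ 0 < A ℓ k

/-- `p` is a Perron eigenvector of `M`, normalized to have sum one. -/
def IsPerronVector {n : Type*} [Fintype n] (M : Matrix n n ℝ) (p : n → ℝ) : Prop :=
  M.mulVec p = p ∧ ∑ i, p i = 1 ∧ ∀ i, 0 < p i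

open Classical in
/-- The Perron eigenvector (unique for a left-stochastic path-connected matrix). -/
def perronVector {n : Type*} [Fintype n] (M : Matrix n n ℝ) : n → ℝ :=
  if h : ∃ p, IsPerronVector M p then h.choose else 0

variable [Fintype V] [DecidableEq V] (A : Matrix V V ℝ) (comp : V → Fin S ⊕ Fin R)

/-- `E = blockdiag {p⁽ˢ⁾ 𝟙ᵀ}`, with `p⁽ˢ⁾` the Perron eigenvector of the `s`-th sending
sub-network. -/
def matE : Matrix (Sending comp) (Sending comp) ℝ := fun ℓ ℓ' =>
  if comp ℓ = comp ℓ' then perronVector (block A comp (comp ℓ)) ⟨ℓ, rfl⟩ else 0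

/-- The weights from sending to receiving agents. -/
def matSR : Matrix (Sending comp) (Receiving comp) ℝ := A.submatrix Subtype.val Subtype.val

/-- The weights among the receiving agents. -/
def matR : Matrix (Receiving comp) (Receiving comp) ℝ := A.submatrix Subtype.val Subtype.val

/-- `W = A_{SR} (I - A_R)⁻¹`. -/
def matW : Matrix (Sending comp) (Receiving comp) ℝ := matSR A comp * (1 - matR A comp)⁻¹

/-- `Ω = E W`, the matrix of limiting combination weights `ω_{ℓk}`. -/
def limitWeights : Matrix (Sending comp) (Receiving comp) ℝ := matE A comp * matW A comp

end Network

/-! ### Data model -/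

section Data

variable {X : Type*} [MeasurableSpace X]

/-- `f` is a probability density with respect to `ν` (a probability density function when `ν` is
a Lebesgue measure, a probability mass function when `ν` is a counting measure). -/
structure IsDensity (ν : Measure X) (f : X → ℝ) : Prop where
  measurable : Measurable f
  nonneg : ∀ x, 0 ≤ f x
  lintegral_eq_one : ∫⁻ x, ENNReal.ofReal (f x) ∂ν = 1

/-- The distribution with density `f` with respect to `ν`. -/
def law (ν : Measure X) (f : X → ℝ) : Measure X := ν.withDensity fun x => ENNReal.ofReal (f x)

/-- The Kullback-Leibler divergence `D[f ‖ g]` of two densities, with values in `[0, ∞]`. -/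
def klDensity (ν : Measure X) (f g : X → ℝ) : ENNReal :=
  InformationTheory.klDiv (law ν f) (law ν g)

end Data

section Divergence

variable {V : Type*} [Fintype V] [DecidableEq V] {S R : ℕ} {Θ : Type*} {X : V → Type*}
  [∀ k, MeasurableSpace (X k)]

/-- The average divergence `𝒟_k(θ) = ∑_{ℓ ∈ 𝒮} ω_{ℓk} D[f_ℓ ‖ L_ℓ(θ)]` at the receiving
agent `k`. -/
def avgDivergence (A : Matrix V V ℝ) (comp : V → Fin S ⊕ Fin R) (ν : ∀ k, Measure (X k))
    (f : ∀ k, X k → ℝ) (L : ∀ k, Θ → X k → ℝ) (k : Receiving comp) (θ : Θ) : ℝ :=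
  ∑ ℓ : Sending comp, limitWeights A comp ℓ k * (klDensity (ν ℓ) (f ℓ) (L ℓ θ)).toReal

end Divergence

/-! ### The log-belief diffusion rule -/

section Diffusion

variable {V : Type*} [Fintype V] {Θ : Type*} [Fintype Θ] {X : V → Type*}

/-- Bayesian update of the beliefs `μ` with the observations `x`. -/
def localUpdate (L : ∀ k, Θ → X k → ℝ) (x : ∀ k, X k) (μ : V → Θ → ℝ) : V → Θ → ℝ := fun k θ =>
  μ k θ * L k θ (x k) / ∑ θ', μ k θ' * L k θ' (x k)

/-- Log-linear combination of the intermediate beliefs `ψ`. -/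
def combine (A : Matrix V V ℝ) (ψ : V → Θ → ℝ) : V → Θ → ℝ := fun k θ =>
  Real.exp (∑ ℓ, A ℓ k * Real.log (ψ ℓ θ)) / ∑ θ', Real.exp (∑ ℓ, A ℓ k * Real.log (ψ ℓ θ'))

/-- The beliefs `μ_{k,i}(θ)` after `i` steps, from the initial beliefs `μ₀` and the observations
`x`. Here `x k i` is what agent `k` observes at time `i + 1`, the time of the `(i+1)`-st step. -/
def belief (A : Matrix V V ℝ) (L : ∀ k, Θ → X k → ℝ) (μ₀ : V → Θ → ℝ) (x : ∀ k, ℕ → X k) :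
    ℕ → V → Θ → ℝ
  | 0 => μ₀
  | i + 1 => combine A (localUpdate L (fun k => x k i) (belief A L μ₀ x i))

end Diffusion

end

end SocialLearning

open SocialLearning

/-! Logarithms linearize the rule. For two hypotheses, both normalizations cancel in the log-belief
ratio, so after `n` steps this ratio is the initial ratio weighted by `A ^ n` plus the
log-likelihood ratios of step `j` weighted by `A ^ (n - j)` (`log_belief_sub`). Divide by `n`. The
initial term vanishes because powers of a stochastic matrix have entries in [0, 1]. The rest splits
into fluctuation and mean.

The fluctuation is, for each of the finitely many agents, an average of centred i.i.d. integrable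
variables with bounded weights that depend on both `n` and `j`. `ae_tendsto_weighted_average` sends
it to zero. Treating agents one at a time is what permits dependence across them.

The mean involves only Cesàro averages of the powers of `A`. Sending sub-networks may be periodic,
so the powers themselves need not converge, but the averages do (`tendsto_powerAverage`): they lie
in a compact set, and each cluster point `C` satisfies `A * C = C = C * A`. These equations
determine `C` block by block: `E` by Perron uniqueness, `Ω` and the zero block by invertibility of
`I - A_R`.

The log-ratio to the minimizer thus has a negative linear rate. All other beliefs vanish, the
minimizer's belief tends to 1, and its logarithm does not affect the rate. -/

/-! ### Strong law for triangular arrays of weights -/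

/-- The truncation error of an integrable variable tends to zero in mean. -/
lemma tendsto_integral_abs_sub_truncation {Ω : Type*} [MeasurableSpace Ω]
    {P : Measure Ω} {Y : Ω → ℝ} (hmeas : Measurable Y)
    (hint : Integrable Y P) :
    Tendsto (fun K : ℕ => ∫ ω, |Y ω - truncation Y K ω| ∂P) atTop (𝓝 0) := by
  have h : Tendsto (fun K : ℕ => ∫ ω, |Y ω - truncation Y K ω| ∂P) atTop
      (𝓝 (∫ _, (0 : ℝ) ∂P)) := by
    refine tendsto_integral_of_dominated_convergence (fun ω => 2 * |Y ω|) (fun K => ?_)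
      (hint.abs.const_mul 2) (fun K => Eventually.of_forall fun ω => ?_)
      (Eventually.of_forall fun ω => ?_)
    · exact (hmeas.aestronglyMeasurable.sub
        hmeas.aestronglyMeasurable.truncation).norm
    · rw [Real.norm_eq_abs, abs_abs]
      have := abs_truncation_le_abs_self Y K ω
      have := abs_sub (Y ω) (truncation Y K ω)
      linarith
    · refine tendsto_const_nhds.congr' ?_
      obtain ⟨N, hN⟩ := exists_nat_gt |Y ω|
      filter_upwards [eventually_ge_atTop N] with K hK
      rw [truncation_eq_self (hN.trans_le (by exact_mod_cast hK)), sub_self, abs_zero]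
  simpa using h

section WeightedStrongLaw

variable {Ω : Type*} [MeasurableSpace Ω] {P : Measure Ω} [IsProbabilityMeasure P]

/-- Hoeffding's inequality and the Borel-Cantelli lemma bound the weighted sums of bounded
independent variables from above. -/
lemma ae_eventually_weighted_sum_lt {Z : ℕ → Ω → ℝ} (hindep : iIndepFun Z P)
    (hmeas : ∀ j, Measurable (Z j)) {K : ℝ} (hK : 0 < K) (hb : ∀ j ω, |Z j ω| ≤ K)
    {c : ℕ → ℕ → ℝ} (hc : ∀ n j, |c n j| ≤ 1) {ε : ℝ} (hε : 0 < ε) :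
    ∀ᵐ ω ∂P, ∀ᶠ n : ℕ in atTop,
      ∑ j ∈ Finset.range n, c n j * (Z j ω - ∫ ω, Z j ω ∂P) < ε * n := by
  -- Hoeffding's parameter for a variable in `[-K, K]`, that is `K ^ 2`; weights of modulus at most
  -- 1 preserve the interval.
  set v : NNReal := (‖K - (-K)‖₊ / 2) ^ 2 with hv
  have hv0 : 0 < v := by
    have : ‖K - (-K)‖₊ ≠ 0 := by
      rw [Ne, nnnorm_eq_zero]; linarith
    positivity
  have hbound : ∀ n : ℕ, P.real {ω | ε * n ≤ ∑ j ∈ Finset.range n,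
      c n j * (Z j ω - ∫ ω, Z j ω ∂P)} ≤ Real.exp (-(ε ^ 2 / (2 * v))) ^ n := by
    intro n
    have hsub : ∀ j < n, HasSubgaussianMGF
        (fun ω => c n j * (Z j ω - ∫ ω, Z j ω ∂P)) v P := by
      intro j _
      have h := hasSubgaussianMGF_of_mem_Icc (μ := P) (X := fun ω => c n j * Z j ω)
        (a := -K) (b := K) ((hmeas j).const_mul _).aemeasurable
        (Eventually.of_forall fun ω => by
          rw [Set.mem_Icc, ← abs_le, abs_mul]
          calc |c n j| * |Z j ω| ≤ 1 * K :=
                mul_le_mul (hc n j) (hb j ω) (abs_nonneg _) zero_le_one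
            _ = K := one_mul K)
      simpa only [integral_const_mul, ← mul_sub] using h
    have hind : iIndepFun (fun j ω => c n j * (Z j ω - ∫ ω, Z j ω ∂P)) P :=
      hindep.comp (fun j x => c n j * (x - ∫ ω, Z j ω ∂P)) fun j => by fun_prop
    refine (HasSubgaussianMGF.measure_sum_range_ge_le_of_iIndepFun hind hsub
      (by positivity)).trans_eq ?_
    rw [← Real.exp_nat_mul]
    congr 1
    rcases Nat.eq_zero_or_pos n with rfl | hn
    · simp
    · have : (n : ℝ) ≠ 0 := by positivity
      have : (v : ℝ) ≠ 0 := by exact_mod_cast hv0.ne'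
      field_simp
  have hr : Real.exp (-(ε ^ 2 / (2 * v))) < 1 := by
    rw [Real.exp_lt_one_iff, neg_lt_zero]
    have : (0 : ℝ) < v := by exact_mod_cast hv0
    positivity
  have hsum : ∑' n : ℕ, P {ω | ε * n ≤ ∑ j ∈ Finset.range n,
      c n j * (Z j ω - ∫ ω, Z j ω ∂P)} ≠ ⊤ := by
    refine ne_top_of_le_ne_top
      (summable_geometric_of_lt_one (Real.exp_pos _).le hr).tsum_ofReal_ne_top
      (ENNReal.tsum_le_tsum fun n => ?_)
    rw [← ofReal_measureReal]
    exact ENNReal.ofReal_le_ofReal (hbound n)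
  filter_upwards [ae_eventually_notMem hsum] with ω hω
  filter_upwards [hω] with n hn
  simpa using hn

/-- The strong law for bounded independent variables with a triangular array of weights. -/
lemma ae_tendsto_weighted_average_of_bounded {Z : ℕ → Ω → ℝ} (hindep : iIndepFun Z P)
    (hmeas : ∀ j, Measurable (Z j)) {K : ℝ} (hK : 0 < K) (hb : ∀ j ω, |Z j ω| ≤ K)
    {c : ℕ → ℕ → ℝ} (hc : ∀ n j, |c n j| ≤ 1) :
    ∀ᵐ ω ∂P, Tendsto (fun n : ℕ =>
      (∑ j ∈ Finset.range n, c n j * (Z j ω - ∫ ω, Z j ω ∂P)) / n) atTop (𝓝 0) := by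
  have h1 := ae_all_iff.2 fun m : ℕ =>
    ae_eventually_weighted_sum_lt hindep hmeas hK hb hc (ε := 1 / (m + 1 : ℝ)) (by positivity)
  have h2 := ae_all_iff.2 fun m : ℕ =>
    ae_eventually_weighted_sum_lt (c := fun n j => -c n j) hindep hmeas hK hb
      (by simpa using hc) (ε := 1 / (m + 1 : ℝ)) (by positivity)
  filter_upwards [h1, h2] with ω hω1 hω2
  rw [Metric.tendsto_nhds]
  intro ε hε
  obtain ⟨m, hm⟩ := exists_nat_one_div_lt hε
  filter_upwards [hω1 m, hω2 m, eventually_gt_atTop 0] with n h1 h2 hn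
  have hn' : (0 : ℝ) < n := by exact_mod_cast hn
  simp only [neg_mul, Finset.sum_neg_distrib] at h2
  rw [Real.dist_eq, sub_zero, abs_div, abs_of_pos hn', div_lt_iff₀ hn', abs_lt]
  have := mul_lt_mul_of_pos_right hm hn'
  constructor <;> linarith

/-- The strong law of large numbers with a bounded triangular array of weights. -/
theorem ae_tendsto_weighted_average {Y : ℕ → Ω → ℝ} (hindep : iIndepFun Y P)
    (hmeas : ∀ j, Measurable (Y j)) (hint : Integrable (Y 0) P)
    (hident : ∀ j, IdentDistrib (Y j) (Y 0) P P)
    {c : ℕ → ℕ → ℝ} (hc : ∀ n j, |c n j| ≤ 1) :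
    ∀ᵐ ω ∂P, Tendsto (fun n : ℕ =>
      (∑ j ∈ Finset.range n, c n j * (Y j ω - ∫ ω, Y 0 ω ∂P)) / n) atTop (𝓝 0) := by
  set τ : ℕ → ℝ → ℝ := fun K => truncation (fun x : ℝ => x) (K : ℝ) with hτ
  have hτm : ∀ K, Measurable (τ K) := fun K =>
    measurable_id.indicator measurableSet_Ioc |>.comp measurable_id
  have hτY : ∀ (K : ℕ) j, truncation (Y j) (K : ℝ) = fun ω => τ K (Y j ω) := fun K j => rfl
  set δ : ℕ → ℝ := fun K => ∫ ω, |Y 0 ω - τ K (Y 0 ω)| ∂P with hδ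
  have hδ0 : Tendsto δ atTop (𝓝 0) := by
    simpa only [hτY] using tendsto_integral_abs_sub_truncation (hmeas 0) hint
  -- The truncation remainder is controlled through its absolute value, so the weights drop out and
  -- the ordinary strong law applies.
  have hrest : ∀ᵐ ω ∂P, ∀ K : ℕ, Tendsto (fun n : ℕ =>
      (∑ j ∈ Finset.range n, |Y j ω - τ K (Y j ω)|) / n) atTop (𝓝 (δ K)) := by
    refine ae_all_iff.2 fun K => ?_
    have hg : Measurable fun x : ℝ => |x - τ K x| :=
      (measurable_id.sub (hτm K)).abs
    refine strong_law_ae_real (fun j ω => |Y j ω - τ K (Y j ω)|) ?_ ?_ ?_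
    · have := (hint.aestronglyMeasurable.integrable_truncation (A := (K : ℝ)))
      exact (hint.sub this).abs
    · intro i j hij
      exact (hindep.indepFun hij).comp hg hg
    · exact fun j => (hident j).comp hg
  have hbdd : ∀ᵐ ω ∂P, ∀ K : ℕ, Tendsto (fun n : ℕ =>
      (∑ j ∈ Finset.range n, c n j * (τ K (Y j ω) - ∫ ω, τ K (Y j ω) ∂P)) / n)
      atTop (𝓝 0) := by
    refine ae_all_iff.2 fun K => ?_
    -- The bound `K + 1` is used because `K = 0` is allowed and the bound has to be positive.
    refine ae_tendsto_weighted_average_of_bounded (Z := fun j ω => τ K (Y j ω)) (K := K + 1)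
      (hindep.comp (fun _ => τ K) fun _ => hτm K) (fun j => (hτm K).comp (hmeas j))
      (by positivity) (fun j ω => ?_) hc
    have := abs_truncation_le_bound (fun x : ℝ => x) (K : ℝ) (Y j ω)
    rw [Nat.abs_cast] at this
    exact this.trans (by linarith)
  filter_upwards [hrest, hbdd] with ω h1 h2
  rw [Metric.tendsto_nhds]
  intro ε hε
  obtain ⟨K, hK⟩ := (hδ0.eventually (gt_mem_nhds (show (0 : ℝ) < ε / 4 by linarith))).exists
  have hmean : ∀ j, |(∫ ω, τ K (Y j ω) ∂P) - ∫ ω, Y 0 ω ∂P| ≤ δ K := by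
    intro j
    have h : ∫ ω, τ K (Y j ω) ∂P = ∫ ω, τ K (Y 0 ω) ∂P :=
      ((hident j).comp (hτm K)).integral_eq
    have hτint : Integrable (fun ω => τ K (Y 0 ω)) P :=
      hint.aestronglyMeasurable.integrable_truncation (A := (K : ℝ))
    rw [h, abs_sub_comm, ← integral_sub hint hτint]
    exact abs_integral_le_integral_abs
  have e1 := (h1 K).eventually (gt_mem_nhds (show δ K < ε / 4 by linarith))
  have e2 := Metric.tendsto_nhds.1 (h2 K) (ε / 4) (by linarith)
  filter_upwards [e1, e2, eventually_gt_atTop 0] with n e1 e2 hn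
  have hn' : (0 : ℝ) < n := by exact_mod_cast hn
  rw [Real.dist_eq, sub_zero, abs_div, abs_of_pos hn', div_lt_iff₀ hn'] at e2 ⊢
  rw [div_lt_iff₀ hn'] at e1
  -- Bounded fluctuation, truncation remainder and shift of the mean each contribute at most `ε / 4
  -- * n`.
  have hsplit : ∑ j ∈ Finset.range n, c n j * (Y j ω - ∫ ω, Y 0 ω ∂P) =
      ∑ j ∈ Finset.range n, c n j * (τ K (Y j ω) - ∫ ω, τ K (Y j ω) ∂P) +
      (∑ j ∈ Finset.range n, c n j * (Y j ω - τ K (Y j ω)) +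
        ∑ j ∈ Finset.range n, c n j * ((∫ ω, τ K (Y j ω) ∂P) - ∫ ω, Y 0 ω ∂P)) := by
    simp only [← Finset.sum_add_distrib]
    exact Finset.sum_congr rfl fun j _ => by ring
  have b1 : |∑ j ∈ Finset.range n, c n j * (Y j ω - τ K (Y j ω))| ≤
      ∑ j ∈ Finset.range n, |Y j ω - τ K (Y j ω)| := by
    refine (Finset.abs_sum_le_sum_abs _ _).trans (Finset.sum_le_sum fun j _ => ?_)
    rw [abs_mul]
    exact mul_le_of_le_one_left (abs_nonneg _) (hc n j)
  have b2 : |∑ j ∈ Finset.range n, c n j * ((∫ ω, τ K (Y j ω) ∂P) - ∫ ω, Y 0 ω ∂P)| ≤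
      ε / 4 * n := by
    refine (Finset.abs_sum_le_sum_abs _ _).trans ?_
    refine (Finset.sum_le_card_nsmul (Finset.range n) _ (ε / 4) fun j _ => ?_).trans_eq ?_
    · rw [abs_mul]
      exact (mul_le_of_le_one_left (abs_nonneg _) (hc n j)).trans ((hmean j).trans hK.le)
    · rw [Finset.card_range, nsmul_eq_mul, mul_comm]
  rw [hsplit]
  have t1 := abs_add_le (∑ j ∈ Finset.range n, c n j * (τ K (Y j ω) - ∫ ω, τ K (Y j ω) ∂P))
    (∑ j ∈ Finset.range n, c n j * (Y j ω - τ K (Y j ω)) +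
        ∑ j ∈ Finset.range n, c n j * ((∫ ω, τ K (Y j ω) ∂P) - ∫ ω, Y 0 ω ∂P))
  have t2 := abs_add_le (∑ j ∈ Finset.range n, c n j * (Y j ω - τ K (Y j ω)))
    (∑ j ∈ Finset.range n, c n j * ((∫ ω, τ K (Y j ω) ∂P) - ∫ ω, Y 0 ω ∂P))
  have : 0 < ε * n := by positivity
  linarith

end WeightedStrongLaw

lemma sum_subtype_eq_sum_of_eq_zero {α : Type*} [Fintype α] {p : α → Prop} [DecidablePred p]
    {g : α → ℝ} (hg : ∀ j, ¬ p j → g j = 0) : ∑ j : {j // p j}, g j = ∑ j, g j := by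
  rw [← Fintype.sum_subtype_add_sum_subtype p g,
    Finset.sum_eq_zero (s := (Finset.univ : Finset {j // ¬ p j})) fun j _ => hg j j.2, add_zero]

/-! ### Uniqueness of the Perron eigenvector -/

section Perron

variable {n : Type*} [Fintype n] {M : Matrix n n ℝ}

/-- A nonzero nonnegative fixed vector of an irreducible matrix is positive. -/
lemma pos_of_mulVec_eq_self (hM : ∀ i j, 0 ≤ M i j) (hconn : PathConnected M) {v : n → ℝ}
    (hv : ∀ i, 0 ≤ v i) (hfix : M.mulVec v = v) {a : n} (ha : 0 < v a) (b : n) : 0 < v b := by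
  induction hconn b a using Relation.ReflTransGen.head_induction_on with
  | refl => exact ha
  | @head b c hbc _ ih =>
    have h : v b = ∑ j, M b j * v j := (congrFun hfix b).symm
    rw [h]
    exact (mul_pos hbc ih).trans_le (Finset.single_le_sum
      (f := fun j => M b j * v j) (fun j _ => mul_nonneg (hM b j) (hv j)) (Finset.mem_univ c))

/-- The Perron eigenvector of an irreducible nonnegative matrix is unique. -/
lemma SocialLearning.IsPerronVector.unique (hM : ∀ i j, 0 ≤ M i j) (hconn : PathConnected M) {p q : n → ℝ}
    (hp : IsPerronVector M p) (hq : IsPerronVector M q) : p = q := by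
  obtain ⟨hp1, hp2, hp3⟩ := hp
  obtain ⟨hq1, hq2, hq3⟩ := hq
  have : Nonempty n := by
    by_contra hne
    rw [not_nonempty_iff] at hne
    simp at hp2
  obtain ⟨i, hi⟩ := Finite.exists_min fun i => q i / p i
  -- With the least ratio `t`, the fixed vector `q - t • p` is nonnegative and vanishes at `i`, so
  -- irreducibility makes it zero; the sums then give `t = 1`.
  set t := q i / p i with ht
  have hv : ∀ j, 0 ≤ q j - t * p j := fun j => by
    have := (le_div_iff₀ (hp3 j)).1 (hi j)
    linarith
  have hvi : q i - t * p i = 0 := by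
    rw [ht, div_mul_cancel₀ _ (hp3 i).ne', sub_self]
  have hfix : M.mulVec (fun j => q j - t * p j) = fun j => q j - t * p j := by
    have : (fun j => q j - t * p j) = q - t • p := by ext j; simp
    rw [this, Matrix.mulVec_sub, Matrix.mulVec_smul, hp1, hq1]
  have hzero : ∀ j, q j = t * p j := fun j => by
    by_contra hne
    have hj : 0 < q j - t * p j := lt_of_le_of_ne (hv j) fun h => hne (by linarith)
    exact (pos_of_mulVec_eq_self hM hconn hv hfix hj i).ne' hvi
  have ht1 : t = 1 := by
    rw [← hq2, Finset.sum_congr rfl fun j _ => hzero j, ← Finset.mul_sum, hp2, mul_one]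
  ext j
  rw [hzero j, ht1, one_mul]

lemma perronVector_eq (hM : ∀ i j, 0 ≤ M i j) (hconn : PathConnected M) {p : n → ℝ}
    (hp : IsPerronVector M p) : perronVector M = p := by
  have h : ∃ p, IsPerronVector M p := ⟨p, hp⟩
  rw [perronVector, dif_pos h]
  exact IsPerronVector.unique hM hconn h.choose_spec hp

end Perron

/-! ### Cesàro averages of matrix powers -/

section Cesaro

variable {V : Type*} [Fintype V] [DecidableEq V]

/-- The averages of the first powers of a matrix. -/
noncomputable def powerAverage (A : Matrix V V ℝ) (n : ℕ) : Matrix V V ℝ :=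
  (n : ℝ)⁻¹ • ∑ m ∈ Finset.range n, A ^ (m + 1)

lemma commute_powerAverage (A : Matrix V V ℝ) (n : ℕ) : Commute A (powerAverage A n) :=
  (Commute.sum_right _ _ _ fun m _ => (Commute.refl A).pow_right (m + 1)).smul_right _

/-- The sum telescopes. With bounded powers, the averages are therefore asymptotically fixed by `A`.
-/
lemma mul_powerAverage_sub (A : Matrix V V ℝ) (n : ℕ) :
    A * powerAverage A n - powerAverage A n = (n : ℝ)⁻¹ • (A ^ (n + 1) - A) := by
  rw [powerAverage, Matrix.mul_smul, ← smul_sub, Finset.mul_sum, ← Finset.sum_sub_distrib]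
  congr 1
  have := Finset.sum_range_sub (fun m => A ^ (m + 1)) n
  simpa only [← pow_succ', zero_add, pow_one] using this

lemma MapClusterPt.eq_of_tendsto {α β : Type*} [TopologicalSpace β] [T2Space β] {l : Filter α}
    {u : α → β} {x y : β} (h : MapClusterPt x l u) (hu : Tendsto u l (𝓝 y)) : x = y :=
  eq_of_nhds_neBot (ClusterPt.mono h hu)

variable {A : Matrix V V ℝ}

lemma tendsto_mul_powerAverage_sub (hA : ∀ n i j, |(A ^ n) i j| ≤ 1) :
    Tendsto (fun n => A * powerAverage A n - powerAverage A n) atTop (𝓝 0) := by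
  simp only [mul_powerAverage_sub]
  refine tendsto_pi_nhds.2 fun i => tendsto_pi_nhds.2 fun j => ?_
  have h2 : Tendsto (fun n : ℕ => (n : ℝ)⁻¹ * 2) atTop (𝓝 0) := by
    simpa using (tendsto_inv_atTop_nhds_zero_nat (𝕜 := ℝ)).mul_const 2
  refine squeeze_zero_norm (fun n => ?_) h2
  rw [Matrix.smul_apply, Matrix.sub_apply, smul_eq_mul, norm_mul, Real.norm_of_nonneg (by positivity),
    Real.norm_eq_abs]
  refine mul_le_mul_of_nonneg_left ?_ (by positivity)
  have h1 := hA 1 i j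
  rw [pow_one] at h1
  have := abs_sub ((A ^ (n + 1)) i j) (A i j)
  linarith [hA (n + 1) i j]

lemma mul_eq_of_mapClusterPt_powerAverage (hA : ∀ n i j, |(A ^ n) i j| ≤ 1) {C : Matrix V V ℝ}
    (hC : MapClusterPt C atTop (powerAverage A)) : A * C = C ∧ C * A = C := by
  have h1 := (hC.continuousAt_comp (f := fun D => A * D - D)
    (by fun_prop)).eq_of_tendsto (tendsto_mul_powerAverage_sub hA)
  have h2 := (hC.continuousAt_comp (f := fun D => D * A - D)
    (by fun_prop)).eq_of_tendsto (y := 0) (by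
      refine (tendsto_mul_powerAverage_sub hA).congr fun n => ?_
      simp only [Function.comp_apply, (commute_powerAverage A n).eq])
  exact ⟨sub_eq_zero.1 h1, sub_eq_zero.1 h2⟩

end Cesaro

/-! ### Limit of the averaged powers of the combination matrix -/

section Network

variable {V : Type*} [Fintype V] {S R : ℕ} {A : Matrix V V ℝ} {comp : V → Fin S ⊕ Fin R}

/-- Left-stochastic matrices in which sending sub-networks have no links from outside. -/
def closedStochastic (comp : V → Fin S ⊕ Fin R) : Set (Matrix V V ℝ) :=
  {C | (∀ ℓ k, 0 ≤ C ℓ k) ∧ (∀ k, ∑ ℓ, C ℓ k = 1) ∧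
    ∀ ℓ k (s : Fin S), comp k = Sum.inl s → comp ℓ ≠ Sum.inl s → C ℓ k = 0}

lemma closedStochastic.le_one {C : Matrix V V ℝ} (hC : C ∈ closedStochastic comp) (ℓ k : V) :
    C ℓ k ≤ 1 := by
  rw [← hC.2.1 k]
  exact Finset.single_le_sum (f := fun ℓ => C ℓ k) (fun j _ => hC.1 j k) (Finset.mem_univ ℓ)

lemma closedStochastic.abs_le_one {C : Matrix V V ℝ} (hC : C ∈ closedStochastic comp)
    (ℓ k : V) : |C ℓ k| ≤ 1 := by
  rw [abs_of_nonneg (hC.1 ℓ k)]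
  exact closedStochastic.le_one hC ℓ k

lemma isCompact_closedStochastic : IsCompact (closedStochastic comp) := by
  have hcpt : IsCompact (Set.pi Set.univ fun _ : V => Set.pi Set.univ fun _ : V =>
      Set.Icc (0 : ℝ) 1) :=
    isCompact_univ_pi fun _ => isCompact_univ_pi fun _ => isCompact_Icc
  refine IsCompact.of_isClosed_subset (X := V → V → ℝ) hcpt ?_ fun C hC ℓ _ k _ =>
    ⟨hC.1 ℓ k, closedStochastic.le_one hC ℓ k⟩
  have he : ∀ ℓ k : V, Continuous fun C : V → V → ℝ => C ℓ k := fun ℓ k => by fun_prop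
  refine IsClosed.inter (s₁ := {C : V → V → ℝ | ∀ ℓ k, 0 ≤ C ℓ k}) ?_
    (IsClosed.inter (s₁ := {C : V → V → ℝ | ∀ k, ∑ ℓ, C ℓ k = 1}) ?_ ?_)
  · simp only [Set.ofPred_forall]
    exact isClosed_iInter fun ℓ => isClosed_iInter fun k =>
      isClosed_le continuous_const (he ℓ k)
  · simp only [Set.ofPred_forall]
    exact isClosed_iInter fun k =>
      isClosed_eq (continuous_finsetSum _ fun ℓ _ => he ℓ k) continuous_const
  · change IsClosed {C : V → V → ℝ | ∀ ℓ k (s : Fin S), comp k = Sum.inl s →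
      comp ℓ ≠ Sum.inl s → C ℓ k = 0}
    simp only [Set.ofPred_forall]
    exact isClosed_iInter fun ℓ => isClosed_iInter fun k => isClosed_iInter fun s =>
      isClosed_iInter fun _ => isClosed_iInter fun _ => isClosed_eq (he ℓ k) continuous_const

lemma closedStochastic.mul {B C : Matrix V V ℝ} (hB : B ∈ closedStochastic comp)
    (hC : C ∈ closedStochastic comp) : B * C ∈ closedStochastic comp := by
  refine ⟨fun ℓ k => ?_, fun k => ?_, fun ℓ k s hk hℓ => ?_⟩
  · exact Finset.sum_nonneg fun j _ => mul_nonneg (hB.1 ℓ j) (hC.1 j k)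
  · simp only [Matrix.mul_apply]
    rw [Finset.sum_comm]
    simp only [← Finset.sum_mul, hB.2.1, one_mul, hC.2.1]
  · rw [Matrix.mul_apply]
    refine Finset.sum_eq_zero fun j _ => ?_
    by_cases hj : comp j = Sum.inl s
    · rw [hB.2.2 ℓ j s hj hℓ, zero_mul]
    · rw [hC.2.2 j k s hk hj, mul_zero]

lemma SocialLearning.IsWeaklyConnected.mem_closedStochastic (hA : IsWeaklyConnected A comp) :
    A ∈ closedStochastic comp := by
  refine ⟨hA.nonneg, hA.sum_col, fun ℓ k s hk hℓ => ?_⟩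
  rcases h : comp ℓ with s' | r
  · exact hA.sending_separate ℓ k s' s h hk fun hs => hℓ (by rw [h, hs])
  · exact hA.no_feedback ℓ k r s h hk

/-- A column of a fixed stochastic matrix at a sending agent is the Perron eigenvector. -/
lemma eq_perronVector_of_mul_eq (hA : IsWeaklyConnected A comp) {C : Matrix V V ℝ}
    (hC : C ∈ closedStochastic comp) (hAC : A * C = C) {s : Fin S} {ℓ k : V}
    (hℓ : comp ℓ = Sum.inl s) (hk : comp k = Sum.inl s) :
    perronVector (block A comp (Sum.inl s)) ⟨ℓ, hℓ⟩ = C ℓ k := by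
  have hsub : ∀ g : V → ℝ, (∀ j, comp j ≠ Sum.inl s → g j = 0) →
      ∑ j : {j // comp j = Sum.inl s}, g j = ∑ j, g j := fun g hg =>
    sum_subtype_eq_sum_of_eq_zero hg
  have hnn : ∀ i j, 0 ≤ block A comp (Sum.inl s) i j := fun i j => hA.nonneg _ _
  have hfix : (block A comp (Sum.inl s)).mulVec (fun j => C j.1 k) =
      fun j => C j.1 k := by
    -- Column `k` of `C` is supported on sub-network `s`, so the sum over all agents reduces to the
    -- block.
    ext i
    have h : ∑ j, A i j * C j k = C i k := congrFun (congrFun hAC i) k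
    rw [← h]
    exact hsub (fun j => A i j * C j k) fun j hj => by rw [hC.2.2 j k s hk hj, mul_zero]
  have hsum : ∑ j : {j // comp j = Sum.inl s}, C j k = 1 := by
    rw [hsub (fun j => C j k) fun j hj => hC.2.2 j k s hk hj, hC.2.1]
  obtain ⟨a, -, ha⟩ : ∃ a ∈ (Finset.univ : Finset {j // comp j = Sum.inl s}), 0 < C a k :=
    Finset.exists_lt_of_sum_lt (f := fun _ => (0 : ℝ)) (by simp [hsum])
  have hp : IsPerronVector (block A comp (Sum.inl s)) fun j => C j.1 k :=
    ⟨hfix, hsum, pos_of_mulVec_eq_self hnn (hA.sending_connected s) (fun j => hC.1 j k) hfix ha⟩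
  rw [perronVector_eq hnn (hA.sending_connected s) hp]

lemma sum_sending_add_sum_receiving (comp : V → Fin S ⊕ Fin R) (g : V → ℝ) :
    ∑ j : Sending comp, g j + ∑ j : Receiving comp, g j = ∑ j, g j := by
  rw [← Fintype.sum_subtype_add_sum_subtype (fun j => (comp j).isLeft = true) g]
  congr 1
  exact Fintype.sum_equiv (Equiv.subtypeEquivRight fun j => by simp) _ _ fun _ => rfl

lemma closedStochastic.receiving_sending_eq_zero {C : Matrix V V ℝ}
    (hC : C ∈ closedStochastic comp) (ℓ : Receiving comp) (k : Sending comp) :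
    C ℓ k = 0 := by
  obtain ⟨s, hs⟩ := Sum.isLeft_iff.1 k.2
  obtain ⟨r, hr⟩ := Sum.isRight_iff.1 ℓ.2
  exact hC.2.2 ℓ k s hs (by simp [hr])

lemma matE_eq_of_mul_eq (hA : IsWeaklyConnected A comp) {C : Matrix V V ℝ}
    (hC : C ∈ closedStochastic comp) (hAC : A * C = C) (ℓ k : Sending comp) :
    matE A comp ℓ k = C ℓ k := by
  obtain ⟨s, hs⟩ := Sum.isLeft_iff.1 k.2
  by_cases h : comp ℓ = comp k
  · have hℓ : comp ℓ = Sum.inl s := h.trans hs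
    rw [matE, if_pos h, ← eq_perronVector_of_mul_eq hA hC hAC hℓ hs]
    have : ∀ (c : Fin S ⊕ Fin R) (hc : comp ℓ = c),
        perronVector (block A comp (comp ℓ)) ⟨ℓ, rfl⟩ = perronVector (block A comp c) ⟨ℓ, hc⟩ := by
      rintro c rfl
      rfl
    exact this _ hℓ
  · rw [matE, if_neg h, hC.2.2 ℓ k s hs fun h' => h (h'.trans hs.symm)]

variable [DecidableEq V]

lemma closedStochastic.pow {B : Matrix V V ℝ} (hB : B ∈ closedStochastic comp) (n : ℕ) :
    B ^ n ∈ closedStochastic comp := by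
  induction n with
  | zero =>
    refine ⟨fun ℓ k => ?_, fun k => ?_, fun ℓ k s hk hℓ => ?_⟩
    · rw [pow_zero, Matrix.one_apply]
      split_ifs <;> simp
    · simp [Matrix.one_apply]
    · rw [pow_zero, Matrix.one_apply_ne]
      rintro rfl
      exact hℓ hk
  | succ n ih =>
    rw [pow_succ]
    exact closedStochastic.mul ih hB

lemma closedStochastic.powerAverage_mem {B : Matrix V V ℝ} (hB : B ∈ closedStochastic comp)
    {n : ℕ} (hn : 0 < n) : powerAverage B n ∈ closedStochastic comp := by
  have happ : ∀ ℓ k, powerAverage B n ℓ k =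
      (n : ℝ)⁻¹ * ∑ m ∈ Finset.range n, (B ^ (m + 1)) ℓ k := fun ℓ k => by
    rw [powerAverage, Matrix.smul_apply, Matrix.sum_apply, smul_eq_mul]
  have hn' : (n : ℝ) ≠ 0 := by positivity
  refine ⟨fun ℓ k => ?_, fun k => ?_, fun ℓ k s hk hℓ => ?_⟩
  · rw [happ]
    exact mul_nonneg (by positivity)
      (Finset.sum_nonneg fun m _ => (closedStochastic.pow hB (m + 1)).1 ℓ k)
  · simp only [happ]
    rw [← Finset.mul_sum, Finset.sum_comm,
      Finset.sum_congr rfl fun m _ => (closedStochastic.pow hB (m + 1)).2.1 k]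
    simp [hn']
  · rw [happ, Finset.sum_eq_zero fun m _ =>
      (closedStochastic.pow hB (m + 1)).2.2 ℓ k s hk hℓ, mul_zero]

/-- `I - A_R` is invertible, since every receiving sub-network is reached by some
sending sub-network. -/
lemma isUnit_det_one_sub_matR (hA : IsWeaklyConnected A comp) (s : Fin S) :
    IsUnit (1 - matR A comp).det := by
  rw [isUnit_iff_ne_zero]
  intro hdet
  obtain ⟨v, hv0, hv⟩ := Matrix.exists_vecMul_eq_zero_iff.2 hdet
  have hfix : ∀ k, v k = ∑ ℓ, v ℓ * matR A comp ℓ k := fun k => by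
    rw [Matrix.vecMul_sub, Matrix.vecMul_one, sub_eq_zero] at hv
    exact congrFun hv k
  obtain ⟨a, ha⟩ := Function.ne_iff.1 hv0
  have : Nonempty (Receiving comp) := ⟨a⟩
  obtain ⟨k₀, hk₀⟩ := Finite.exists_max fun k => |v k|
  have hm : 0 < |v k₀| := (abs_pos.2 ha).trans_le (hk₀ a)
  set m := |v k₀| with hm_def
  let w : V → ℝ := fun ℓ => if h : (comp ℓ).isRight = true then |v ⟨ℓ, h⟩| else 0
  have hwR : ∀ k : Receiving comp, w k = |v k| := fun k => dif_pos k.2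
  have hw_le : ∀ ℓ, w ℓ ≤ m := fun ℓ => by
    by_cases h : (comp ℓ).isRight = true
    · exact (hwR ⟨ℓ, h⟩).trans_le (hk₀ _)
    · simp only [w, dif_neg h]
      exact hm.le
  have hsum : ∀ k : V, ∑ ℓ, w ℓ * A ℓ k = ∑ ℓ : Receiving comp, |v ℓ| * A ℓ k := fun k => by
    rw [← sum_subtype_eq_sum_of_eq_zero (p := fun ℓ => (comp ℓ).isRight = true)]
    · exact Finset.sum_congr rfl fun ℓ _ => by rw [hwR]
    · intro j hj
      simp only [w, dif_neg hj, zero_mul]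
  -- Maximum principle: `w k` is at most an average of the values `w ℓ` with weights `A ℓ k` of sum
  -- 1, so a maximum at `k` spreads to every agent with a link to `k`.
  have hstep : ∀ k ℓ, w k = m → 0 < A ℓ k → w ℓ = m := by
    intro k ℓ hk hℓ
    have hkR : (comp k).isRight = true := by
      by_contra h
      simp only [w, dif_neg h] at hk
      exact hm.ne hk
    have hle : w k ≤ ∑ ℓ, w ℓ * A ℓ k := by
      rw [hsum, hwR ⟨k, hkR⟩, hfix ⟨k, hkR⟩]
      refine (Finset.abs_sum_le_sum_abs _ _).trans_eq (Finset.sum_congr rfl fun j _ => ?_)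
      rw [abs_mul, matR, Matrix.submatrix_apply, abs_of_nonneg (hA.nonneg _ _)]
    have hnn : ∀ j ∈ Finset.univ, 0 ≤ (m - w j) * A j k := fun j _ =>
      mul_nonneg (sub_nonneg.2 (hw_le j)) (hA.nonneg j k)
    have hzero : ∑ j, (m - w j) * A j k = 0 := by
      refine le_antisymm ?_ (Finset.sum_nonneg hnn)
      simp only [sub_mul, Finset.sum_sub_distrib]
      rw [← Finset.mul_sum, hA.sum_col]
      linarith
    have := (Finset.sum_eq_zero_iff_of_nonneg hnn).1 hzero ℓ (Finset.mem_univ ℓ)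
    rcases mul_eq_zero.1 this with h | h
    · linarith
    · exact absurd h hℓ.ne'
  obtain ⟨r, hr⟩ := Sum.isRight_iff.1 k₀.2
  have hcomp : ∀ b : {ℓ : V // comp ℓ = Sum.inr r}, w b = m := fun b => by
    induction hA.receiving_connected r b ⟨k₀, hr⟩ using
      Relation.ReflTransGen.head_induction_on with
    | refl => exact hwR k₀
    | @head b c hbc _ ih => exact hstep c b ih hbc
  -- The maximum has filled a whole receiving sub-network; a link from a sending agent carries it to
  -- a place where `w` is zero.
  obtain ⟨ℓ, k, hℓ, hk, hpos⟩ := hA.reached s r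
  have := hstep k ℓ (hcomp ⟨k, hk⟩) hpos
  simp only [w, hℓ, Sum.isRight_inl, Bool.false_eq_true, dite_false] at this
  exact hm.ne this

/-- The limit of the averaged powers of the combination matrix. -/
noncomputable def limitMatrix (A : Matrix V V ℝ) (comp : V → Fin S ⊕ Fin R) : Matrix V V ℝ :=
  fun ℓ k =>
    if hℓ : (comp ℓ).isLeft = true then
      if hk : (comp k).isLeft = true then matE A comp ⟨ℓ, hℓ⟩ ⟨k, hk⟩
      else limitWeights A comp ⟨ℓ, hℓ⟩ ⟨k, by simpa using hk⟩
    else 0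

/-- The sending-receiving block of `C * A = C` reads `D = E A_SR + D A_R`, which is solved for `D`
by inverting `I - A_R`. -/
lemma eq_limitWeights_of_mul_eq (hA : IsWeaklyConnected A comp) (s : Fin S) {C : Matrix V V ℝ}
    (hC : C ∈ closedStochastic comp) (hAC : A * C = C) (hCA : C * A = C)
    (ℓ : Sending comp) (k : Receiving comp) : C ℓ k = limitWeights A comp ℓ k := by
  let D : Matrix (Sending comp) (Receiving comp) ℝ := C.submatrix Subtype.val Subtype.val
  have hD : D * (1 - matR A comp) = matE A comp * matSR A comp := by
    ext i j
    have h : ∑ a, C i a * A a j = C i j := congrFun (congrFun hCA i) j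
    rw [← sum_sending_add_sum_receiving comp] at h
    rw [Matrix.mul_sub, Matrix.mul_one, Matrix.sub_apply, Matrix.mul_apply, Matrix.mul_apply]
    simp only [matE_eq_of_mul_eq hA hC hAC, matR, matSR, D, Matrix.submatrix_apply]
    linarith
  have h : D = limitWeights A comp := by
    rw [limitWeights, matW, ← Matrix.mul_assoc, ← hD,
      Matrix.mul_nonsing_inv_cancel_right _ _ (isUnit_det_one_sub_matR hA s)]
  exact congrFun (congrFun h ℓ) k

/-- As `C` has no receiving-sending entries, this block satisfies `D = D A_R`, and `I - A_R` is
invertible. -/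
lemma receiving_receiving_eq_zero_of_mul_eq (hA : IsWeaklyConnected A comp) (s : Fin S)
    {C : Matrix V V ℝ} (hC : C ∈ closedStochastic comp) (hCA : C * A = C)
    (ℓ k : Receiving comp) : C ℓ k = 0 := by
  let D : Matrix (Receiving comp) (Receiving comp) ℝ := C.submatrix Subtype.val Subtype.val
  have hD : D * (1 - matR A comp) = 0 := by
    ext i j
    have h : ∑ a, C i a * A a j = C i j := congrFun (congrFun hCA i) j
    rw [← sum_sending_add_sum_receiving comp, Finset.sum_eq_zero fun a _ => by
      rw [closedStochastic.receiving_sending_eq_zero hC, zero_mul]] at h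
    rw [Matrix.mul_sub, Matrix.mul_one, Matrix.sub_apply, Matrix.mul_apply]
    simp only [matR, D, Matrix.submatrix_apply, Matrix.zero_apply]
    linarith
  have h : D = 0 := by
    rw [← Matrix.mul_nonsing_inv_cancel_right _ D (isUnit_det_one_sub_matR hA s), hD,
      Matrix.zero_mul]
  exact congrFun (congrFun h ℓ) k

lemma eq_limitMatrix_of_mul_eq (hA : IsWeaklyConnected A comp) (s : Fin S) {C : Matrix V V ℝ}
    (hC : C ∈ closedStochastic comp) (hAC : A * C = C) (hCA : C * A = C) :
    C = limitMatrix A comp := by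
  ext ℓ k
  unfold limitMatrix
  split_ifs with hℓ hk
  · exact (matE_eq_of_mul_eq hA hC hAC ⟨ℓ, hℓ⟩ ⟨k, hk⟩).symm
  · exact eq_limitWeights_of_mul_eq hA s hC hAC hCA ⟨ℓ, hℓ⟩ ⟨k, by simpa using hk⟩
  · have hℓ' : (comp ℓ).isRight = true := by simpa using hℓ
    by_cases hk : (comp k).isLeft = true
    · exact closedStochastic.receiving_sending_eq_zero hC ⟨ℓ, hℓ'⟩ ⟨k, hk⟩
    · exact receiving_receiving_eq_zero_of_mul_eq hA s hC hCA ⟨ℓ, hℓ'⟩ ⟨k, by simpa using hk⟩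

/-- The averaged powers of the combination matrix of a weakly connected network converge, also
when the sending sub-networks are periodic. -/
theorem tendsto_powerAverage (hA : IsWeaklyConnected A comp) (s : Fin S) :
    Tendsto (powerAverage A) atTop (𝓝 (limitMatrix A comp)) := by
  have hmem := hA.mem_closedStochastic
  -- In a compact set a unique cluster point is the limit. The index 0 is excluded, as the empty
  -- average is the zero matrix.
  refine isCompact_closedStochastic.tendsto_nhds_of_unique_mapClusterPt
    ((eventually_gt_atTop 0).mono fun n hn => closedStochastic.powerAverage_mem hmem hn)
    fun C hC hcl => ?_
  obtain ⟨hAC, hCA⟩ := mul_eq_of_mapClusterPt_powerAverage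
    (fun n i j => closedStochastic.abs_le_one (closedStochastic.pow hmem n) i j) hcl
  exact eq_limitMatrix_of_mul_eq hA s hC hAC hCA

lemma tendsto_average_pow_mul (hA : IsWeaklyConnected A comp) (s : Fin S) (k : Receiving comp)
    (x : V → ℝ) :
    Tendsto (fun n : ℕ => (∑ j ∈ Finset.range n, ∑ ℓ, (A ^ (n - j)) ℓ k * x ℓ) / n) atTop
      (𝓝 (∑ ℓ : Sending comp, limitWeights A comp ℓ k * x ℓ)) := by
  have hlim : ∑ ℓ, limitMatrix A comp ℓ k * x ℓ =
      ∑ ℓ : Sending comp, limitWeights A comp ℓ k * x ℓ := by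
    have hk : ¬ (comp k).isLeft = true := by simpa using k.2
    rw [← sum_sending_add_sum_receiving comp, Finset.sum_eq_zero (s := (Finset.univ :
      Finset (Receiving comp))), add_zero]
    · exact Finset.sum_congr rfl fun ℓ _ => by
        rw [limitMatrix, dif_pos ℓ.2, dif_neg hk]
    · intro ℓ _
      rw [limitMatrix, dif_neg (by simpa using ℓ.2), zero_mul]
  rw [← hlim]
  have h : Tendsto (fun n => ∑ ℓ, powerAverage A n ℓ k * x ℓ) atTop
      (𝓝 (∑ ℓ, limitMatrix A comp ℓ k * x ℓ)) :=
    tendsto_finsetSum _ fun ℓ _ =>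
      (tendsto_pi_nhds.1 (tendsto_pi_nhds.1 (tendsto_powerAverage hA s) ℓ) k).mul_const _
  refine h.congr fun n => ?_
  rw [Finset.sum_comm, Finset.sum_div]
  refine Finset.sum_congr rfl fun ℓ _ => ?_
  rw [powerAverage, Matrix.smul_apply, Matrix.sum_apply, smul_eq_mul, ← Finset.sum_mul,
    ← Finset.sum_range_reflect fun m => (A ^ (m + 1)) ℓ k, div_eq_inv_mul, mul_assoc]
  congr 2
  refine Finset.sum_congr rfl fun j hj => ?_
  rw [show n - 1 - j + 1 = n - j by have := Finset.mem_range.1 hj; omega]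

end Network

/-! ### Divergences as expected log-likelihood ratios -/

section LogLikelihood

variable {X : Type*} [MeasurableSpace X] {ν : Measure X} {f g : X → ℝ}

lemma SocialLearning.IsDensity.isProbabilityMeasure_law (hf : IsDensity ν f) :
    IsProbabilityMeasure (law ν f) :=
  ⟨by rw [law, withDensity_apply _ MeasurableSet.univ, Measure.restrict_univ,
    hf.lintegral_eq_one]⟩

lemma SocialLearning.IsDensity.ae_law_pos (hf : IsDensity ν f) : ∀ᵐ x ∂law ν f, 0 < f x := by
  rw [law, ae_withDensity_iff hf.measurable.ennreal_ofReal]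
  refine Eventually.of_forall fun x hx => ?_
  simpa using hx

lemma ae_law_pos_of_absolutelyContinuous (hg : IsDensity ν g)
    (h : law ν f ≪ law ν g) : ∀ᵐ x ∂law ν f, 0 < g x :=
  h.ae_le hg.ae_law_pos

/-- The density of `law ν f` with respect to `law ν g`; `ν` need not be `σ`-finite. -/
lemma rnDeriv_law_ae_eq (hf : IsDensity ν f) (hg : IsDensity ν g) (h : law ν f ≪ law ν g) :
    (law ν f).rnDeriv (law ν g) =ᵐ[law ν g]
      fun x => ENNReal.ofReal (f x) / ENNReal.ofReal (g x) := by
  have := hg.isProbabilityMeasure_law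
  have hq : Measurable fun x => ENNReal.ofReal (f x) / ENNReal.ofReal (g x) :=
    hf.measurable.ennreal_ofReal.div hg.measurable.ennreal_ofReal
  have hfg : law ν f =
      (law ν g).withDensity fun x => ENNReal.ofReal (f x) / ENNReal.ofReal (g x) := by
    rw [law, law, ← withDensity_mul ν hg.measurable.ennreal_ofReal hq]
    refine withDensity_congr_ae ?_
    -- Absolute continuity gives `g > 0` wherever `f > 0`, up to a null set, so `g * (f / g) = f`
    -- there.
    have hpos := ae_law_pos_of_absolutelyContinuous hg h
    rw [law, ae_withDensity_iff hf.measurable.ennreal_ofReal] at hpos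
    filter_upwards [hpos] with x hx
    by_cases h0 : ENNReal.ofReal (f x) = 0
    · simp [h0]
    · have := hx h0
      rw [Pi.mul_apply, ENNReal.mul_div_cancel]
      · simpa using this
      · exact ENNReal.ofReal_ne_top
  conv_lhs => rw [hfg]
  exact Measure.rnDeriv_withDensity _ hq

lemma llr_law_ae_eq (hf : IsDensity ν f) (hg : IsDensity ν g) (h : law ν f ≪ law ν g) :
    llr (law ν f) (law ν g) =ᵐ[law ν f] fun x => Real.log (f x) - Real.log (g x) := by
  filter_upwards [h.ae_le (rnDeriv_law_ae_eq hf hg h), hf.ae_law_pos,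
    ae_law_pos_of_absolutelyContinuous hg h] with x hx hfx hgx
  rw [llr, hx, ENNReal.toReal_div, ENNReal.toReal_ofReal hfx.le, ENNReal.toReal_ofReal hgx.le,
    Real.log_div hfx.ne' hgx.ne']

lemma ae_law_pos_of_klDensity_lt_top (hg : IsDensity ν g) (h : klDensity ν f g < ⊤) :
    ∀ᵐ x ∂law ν f, 0 < g x :=
  ae_law_pos_of_absolutelyContinuous hg (InformationTheory.klDiv_ne_top_iff.1 h.ne).1

lemma integrable_log_sub_log_of_klDensity_lt_top (hf : IsDensity ν f) (hg : IsDensity ν g)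
    (h : klDensity ν f g < ⊤) :
    Integrable (fun x => Real.log (f x) - Real.log (g x)) (law ν f) := by
  obtain ⟨hac, hint⟩ := InformationTheory.klDiv_ne_top_iff.1 h.ne
  exact hint.congr (llr_law_ae_eq hf hg hac)

lemma integral_log_sub_log_of_klDensity_lt_top (hf : IsDensity ν f) (hg : IsDensity ν g)
    (h : klDensity ν f g < ⊤) :
    ∫ x, (Real.log (f x) - Real.log (g x)) ∂law ν f = (klDensity ν f g).toReal := by
  have := hf.isProbabilityMeasure_law
  have := hg.isProbabilityMeasure_law
  obtain ⟨hac, hint⟩ := InformationTheory.klDiv_ne_top_iff.1 h.ne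
  rw [klDensity, InformationTheory.toReal_klDiv_of_measure_eq hac (by simp),
    integral_congr_ae (llr_law_ae_eq hf hg hac)]

/-- The log-likelihood ratio of two models at finite divergence from the truth. -/
lemma integrable_log_likelihood_ratio {g' : X → ℝ} (hf : IsDensity ν f) (hg : IsDensity ν g)
    (hg' : IsDensity ν g') (h : klDensity ν f g < ⊤) (h' : klDensity ν f g' < ⊤) :
    Integrable (fun x => Real.log (g x) - Real.log (g' x)) (law ν f) := by
  refine ((integrable_log_sub_log_of_klDensity_lt_top hf hg' h').sub
    (integrable_log_sub_log_of_klDensity_lt_top hf hg h)).congr (Eventually.of_forall fun x => ?_)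
  simp

/-- The entropy term `log f` cancels between the two divergences. -/
lemma integral_log_likelihood_ratio {g' : X → ℝ} (hf : IsDensity ν f) (hg : IsDensity ν g)
    (hg' : IsDensity ν g') (h : klDensity ν f g < ⊤) (h' : klDensity ν f g' < ⊤) :
    ∫ x, (Real.log (g x) - Real.log (g' x)) ∂law ν f =
      (klDensity ν f g').toReal - (klDensity ν f g).toReal := by
  rw [← integral_log_sub_log_of_klDensity_lt_top hf hg h,
    ← integral_log_sub_log_of_klDensity_lt_top hf hg' h', ← integral_sub
      (integrable_log_sub_log_of_klDensity_lt_top hf hg' h')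
      (integrable_log_sub_log_of_klDensity_lt_top hf hg h)]
  simp

end LogLikelihood

/-! ### Linear recursion for log-belief ratios -/

section Beliefs

lemma log_localUpdate_sub {V Θ : Type*} [Fintype Θ] [Nonempty Θ] {X : V → Type*}
    {L : ∀ k, Θ → X k → ℝ} {y : ∀ k, X k} {μ : V → Θ → ℝ} {k : V}
    (hL : ∀ θ, 0 < L k θ (y k)) (hμ : ∀ θ, 0 < μ k θ) (θ θ' : Θ) :
    Real.log (localUpdate L y μ k θ) - Real.log (localUpdate L y μ k θ') =
      (Real.log (μ k θ) - Real.log (μ k θ')) +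
        (Real.log (L k θ (y k)) - Real.log (L k θ' (y k))) := by
  have h : 0 < ∑ θ', μ k θ' * L k θ' (y k) :=
    Finset.sum_pos (fun θ _ => mul_pos (hμ θ) (hL θ)) Finset.univ_nonempty
  rw [localUpdate, localUpdate, Real.log_div (mul_pos (hμ θ) (hL θ)).ne' h.ne',
    Real.log_div (mul_pos (hμ θ') (hL θ')).ne' h.ne', Real.log_mul (hμ θ).ne' (hL θ).ne',
    Real.log_mul (hμ θ').ne' (hL θ').ne']
  ring

variable {V : Type*} [Fintype V] {Θ : Type*} [Fintype Θ] {X : V → Type*}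
  {A : Matrix V V ℝ} {L : ∀ k, Θ → X k → ℝ} {μ₀ : V → Θ → ℝ} {x : ∀ k, ℕ → X k}

lemma combine_pos [Nonempty Θ] (A : Matrix V V ℝ) (ψ : V → Θ → ℝ) (k : V) (θ : Θ) :
    0 < combine A ψ k θ :=
  div_pos (Real.exp_pos _) (Finset.sum_pos (fun _ _ => Real.exp_pos _) Finset.univ_nonempty)

lemma sum_combine [Nonempty Θ] (A : Matrix V V ℝ) (ψ : V → Θ → ℝ) (k : V) :
    ∑ θ, combine A ψ k θ = 1 := by
  simp only [combine, ← Finset.sum_div]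
  exact div_self (Finset.sum_pos (fun _ _ => Real.exp_pos _) Finset.univ_nonempty).ne'

lemma belief_pos [Nonempty Θ] (hμ₀ : ∀ k θ, 0 < μ₀ k θ) (n : ℕ) (k : V) (θ : Θ) :
    0 < belief A L μ₀ x n k θ := by
  cases n with
  | zero => exact hμ₀ k θ
  | succ n => exact combine_pos _ _ _ _

lemma sum_belief [Nonempty Θ] (hμ₀ : ∀ k, ∑ θ, μ₀ k θ = 1) (n : ℕ) (k : V) :
    ∑ θ, belief A L μ₀ x n k θ = 1 := by
  cases n with
  | zero => exact hμ₀ k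
  | succ n => exact sum_combine _ _ _

lemma log_combine_sub [Nonempty Θ] (A : Matrix V V ℝ) (ψ : V → Θ → ℝ) (k : V) (θ θ' : Θ) :
    Real.log (combine A ψ k θ) - Real.log (combine A ψ k θ') =
      ∑ ℓ, A ℓ k * (Real.log (ψ ℓ θ) - Real.log (ψ ℓ θ')) := by
  have h : (0 : ℝ) < ∑ θ', Real.exp (∑ ℓ, A ℓ k * Real.log (ψ ℓ θ')) :=
    Finset.sum_pos (fun _ _ => Real.exp_pos _) Finset.univ_nonempty
  rw [combine, combine, Real.log_div (Real.exp_ne_zero _) h.ne',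
    Real.log_div (Real.exp_ne_zero _) h.ne', Real.log_exp, Real.log_exp]
  simp only [mul_sub, Finset.sum_sub_distrib]
  ring

/-- The log-belief ratios are driven linearly by the log-likelihood ratios. -/
lemma log_belief_sub [DecidableEq V] [Nonempty Θ] (hμ₀ : ∀ k θ, 0 < μ₀ k θ)
    (hL : ∀ k θ j, 0 < L k θ (x k j)) (θ θ' : Θ) (n : ℕ) (k : V) :
    Real.log (belief A L μ₀ x n k θ) - Real.log (belief A L μ₀ x n k θ') =
      ∑ ℓ, (A ^ n) ℓ k * (Real.log (μ₀ ℓ θ) - Real.log (μ₀ ℓ θ')) +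
      ∑ j ∈ Finset.range n, ∑ ℓ, (A ^ (n - j)) ℓ k *
        (Real.log (L ℓ θ (x ℓ j)) - Real.log (L ℓ θ' (x ℓ j))) := by
  have key : ∀ (m : ℕ) (z : V → ℝ) (k : V),
      ∑ i, A i k * ∑ ℓ, (A ^ m) ℓ i * z ℓ = ∑ ℓ, (A ^ (m + 1)) ℓ k * z ℓ := by
    intro m z k
    simp only [pow_succ, Matrix.mul_apply, Finset.mul_sum, Finset.sum_mul]
    rw [Finset.sum_comm]
    exact Finset.sum_congr rfl fun _ _ => Finset.sum_congr rfl fun _ _ => by ring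
  induction n generalizing k with
  | zero => simp [belief, Matrix.one_apply]
  | succ n ih =>
    rw [belief, log_combine_sub]
    have hstep : ∀ ℓ, _ := fun ℓ => log_localUpdate_sub (y := fun k => x k n)
      (μ := belief A L μ₀ x n) (k := ℓ) (fun θ => hL ℓ θ n) (belief_pos hμ₀ n ℓ) θ θ'
    simp only [hstep, ih, mul_add, Finset.sum_add_distrib]
    rw [key, Finset.sum_range_succ, ← add_assoc]
    congr 1
    · congr 1
      simp only [Finset.mul_sum (s := Finset.range n)]
      rw [Finset.sum_comm]
      refine Finset.sum_congr rfl fun j hj => ?_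
      rw [key, show n + 1 - j = n - j + 1 by have := Finset.mem_range.1 hj; omega]
    -- The newest observation is combined in the same step, so it carries `A ^ 1`.
    · simp

/-- If all log-ratios to `θ'` decrease linearly, the belief concentrates at `θ'`. -/
lemma tendsto_of_log_ratio {b : ℕ → Θ → ℝ} (hpos : ∀ n θ, 0 < b n θ)
    (hsum : ∀ n, ∑ θ, b n θ = 1) {θ' : Θ} {d : Θ → ℝ} (hd : ∀ θ, θ ≠ θ' → d θ < 0)
    (h : ∀ θ, θ ≠ θ' → Tendsto (fun n : ℕ => (Real.log (b n θ) - Real.log (b n θ')) / n) atTop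
      (𝓝 (d θ))) :
    Tendsto (fun n => b n θ') atTop (𝓝 1) ∧
      ∀ θ, θ ≠ θ' → Tendsto (fun n : ℕ => Real.log (b n θ) / n) atTop (𝓝 (d θ)) := by
  classical
  have hratio : ∀ θ, θ ≠ θ' → Tendsto (fun n => b n θ) atTop (𝓝 0) := by
    intro θ hθ
    have hbot : Tendsto (fun n : ℕ => Real.log (b n θ) - Real.log (b n θ')) atTop atBot := by
      refine ((h θ hθ).neg_mul_atTop (hd θ hθ) tendsto_natCast_atTop_atTop).congr' ?_
      filter_upwards [eventually_gt_atTop 0] with n hn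
      have : (n : ℝ) ≠ 0 := by positivity
      field_simp
    refine squeeze_zero (fun n => (hpos n θ).le) (fun n => ?_)
      (Real.tendsto_exp_atBot.comp hbot)
    have h1 : b n θ' ≤ 1 := by
      rw [← hsum n]
      exact Finset.single_le_sum (f := b n) (fun θ _ => (hpos n θ).le) (Finset.mem_univ θ')
    rw [Function.comp_apply, Real.exp_sub, Real.exp_log (hpos n θ), Real.exp_log (hpos n θ'),
      le_div_iff₀ (hpos n θ')]
    exact mul_le_of_le_one_right (hpos n θ).le h1
  have hone : Tendsto (fun n => b n θ') atTop (𝓝 1) := by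
    have : Tendsto (fun n => 1 - ∑ θ ∈ Finset.univ.erase θ', b n θ) atTop (𝓝 (1 - ∑ θ ∈
        Finset.univ.erase θ', (0 : ℝ))) :=
      tendsto_const_nhds.sub
        (tendsto_finsetSum _ fun θ hθ => hratio θ (Finset.ne_of_mem_erase hθ))
    rw [Finset.sum_const_zero, sub_zero] at this
    refine this.congr fun n => ?_
    rw [← hsum n, ← Finset.add_sum_erase _ _ (Finset.mem_univ θ'), add_sub_cancel_right]
  refine ⟨hone, fun θ hθ => ?_⟩
  -- As the belief at `θ'` tends to 1, dropping its logarithm from the ratio leaves the rate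
  -- unchanged.
  have hlog : Tendsto (fun n : ℕ => Real.log (b n θ') * (n : ℝ)⁻¹) atTop (𝓝 (Real.log 1 * 0)) :=
    (hone.log one_ne_zero).mul tendsto_inv_atTop_nhds_zero_nat
  rw [mul_zero] at hlog
  have := (h θ hθ).add hlog
  rw [add_zero] at this
  refine this.congr fun n => ?_
  ring

end Beliefs

/-! ### Almost sure rate of the log-belief ratios -/

section LogRatioLimit

variable {V : Type*} {Θ : Type*} {X : V → Type*} [∀ k, MeasurableSpace (X k)]
  {Ω : Type*} [MeasurableSpace Ω] {P : Measure Ω}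
  {ν : ∀ k, Measure (X k)} {f : ∀ k, X k → ℝ} {L : ∀ k, Θ → X k → ℝ} {ξ : ∀ k, ℕ → Ω → X k}

/-- Finite divergence forces absolute continuity. Almost surely every observed likelihood is then
positive, and the convention `Real.log 0 = 0` never intervenes. -/
lemma ae_likelihood_pos [Countable V] [Countable Θ] (hL : ∀ k θ, IsDensity (ν k) (L k θ))
    (hξ : ∀ k i, Measurable (ξ k i)) (hlaw : ∀ k i, P.map (ξ k i) = law (ν k) (f k))
    (hKL : ∀ k θ, klDensity (ν k) (f k) (L k θ) < ⊤) :
    ∀ᵐ ω ∂P, ∀ k θ j, 0 < L k θ (ξ k j ω) := by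
  refine ae_all_iff.2 fun k => ae_all_iff.2 fun θ => ae_all_iff.2 fun j => ?_
  have h := ae_law_pos_of_klDensity_lt_top (hL k θ) (hKL k θ)
  rw [← hlaw k j] at h
  exact ae_of_ae_map (hξ k j).aemeasurable h

/-- The strong law for the log-likelihood ratios that an agent observes. -/
lemma ae_tendsto_weighted_average_log_likelihood_ratio [IsProbabilityMeasure P]
    (hf : ∀ k, IsDensity (ν k) (f k)) (hL : ∀ k θ, IsDensity (ν k) (L k θ))
    (hξ : ∀ k i, Measurable (ξ k i)) (hlaw : ∀ k i, P.map (ξ k i) = law (ν k) (f k))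
    (hindep : iIndepFun (fun (i : ℕ) (ω : Ω) (k : V) => ξ k i ω) P)
    (hKL : ∀ k θ, klDensity (ν k) (f k) (L k θ) < ⊤) {c : ℕ → ℕ → ℝ} (hc : ∀ n j, |c n j| ≤ 1)
    (ℓ : V) (θ θ' : Θ) :
    ∀ᵐ ω ∂P, Tendsto (fun n : ℕ => (∑ j ∈ Finset.range n, c n j *
      (Real.log (L ℓ θ (ξ ℓ j ω)) - Real.log (L ℓ θ' (ξ ℓ j ω)) -
        ((klDensity (ν ℓ) (f ℓ) (L ℓ θ')).toReal - (klDensity (ν ℓ) (f ℓ) (L ℓ θ)).toReal))) / n)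
      atTop (𝓝 0) := by
  set h : X ℓ → ℝ := fun x => Real.log (L ℓ θ x) - Real.log (L ℓ θ' x) with hh
  have hm : Measurable h :=
    (Real.measurable_log.comp (hL ℓ θ).measurable).sub
      (Real.measurable_log.comp (hL ℓ θ').measurable)
  have hint : Integrable h (P.map (ξ ℓ 0)) := by
    rw [hlaw]
    exact integrable_log_likelihood_ratio (hf ℓ) (hL ℓ θ) (hL ℓ θ') (hKL ℓ θ) (hKL ℓ θ')
  have hmean : ∫ ω, h (ξ ℓ 0 ω) ∂P =
      (klDensity (ν ℓ) (f ℓ) (L ℓ θ')).toReal - (klDensity (ν ℓ) (f ℓ) (L ℓ θ)).toReal := by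
    rw [← integral_map (hξ ℓ 0).aemeasurable hm.aestronglyMeasurable, hlaw]
    exact integral_log_likelihood_ratio (hf ℓ) (hL ℓ θ) (hL ℓ θ') (hKL ℓ θ) (hKL ℓ θ')
  rw [← hmean]
  refine ae_tendsto_weighted_average (Y := fun j ω => h (ξ ℓ j ω))
    (hindep.comp (fun _ x => h (x ℓ)) fun _ => hm.comp (measurable_pi_apply ℓ))
    (fun j => hm.comp (hξ ℓ j)) (hint.comp_measurable (hξ ℓ 0)) (fun j => ?_) hc
  exact IdentDistrib.comp
    ⟨(hξ ℓ j).aemeasurable, (hξ ℓ 0).aemeasurable, by rw [hlaw, hlaw]⟩ hm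

/-- Almost surely the log-belief ratios at a receiving agent grow linearly, at the rate given by
the average divergences. -/
theorem ae_tendsto_log_belief_ratio [Fintype V] [DecidableEq V] {S R : ℕ} [Fintype Θ]
    [Nonempty Θ] [IsProbabilityMeasure P] {A : Matrix V V ℝ} {comp : V → Fin S ⊕ Fin R}
    (hA : IsWeaklyConnected A comp) (s : Fin S)
    (hf : ∀ k, IsDensity (ν k) (f k)) (hL : ∀ k θ, IsDensity (ν k) (L k θ))
    (hξ : ∀ k i, Measurable (ξ k i)) (hlaw : ∀ k i, P.map (ξ k i) = law (ν k) (f k))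
    (hindep : iIndepFun (fun (i : ℕ) (ω : Ω) (k : V) => ξ k i ω) P)
    (hKL : ∀ k θ, klDensity (ν k) (f k) (L k θ) < ⊤)
    {μ₀ : V → Θ → ℝ} (hμ₀ : ∀ k θ, 0 < μ₀ k θ) (k : Receiving comp) (θ θ' : Θ) :
    ∀ᵐ ω ∂P, Tendsto (fun n : ℕ =>
      (Real.log (belief A L μ₀ (fun ℓ j => ξ ℓ j ω) n k θ) -
        Real.log (belief A L μ₀ (fun ℓ j => ξ ℓ j ω) n k θ')) / (n : ℝ)) atTop
      (𝓝 (avgDivergence A comp ν f L k θ' - avgDivergence A comp ν f L k θ)) := by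
  have hpow : ∀ m ℓ, |(A ^ m) ℓ (k : V)| ≤ 1 := fun m ℓ =>
    closedStochastic.abs_le_one (closedStochastic.pow hA.mem_closedStochastic m) ℓ k
  set d : V → ℝ := fun ℓ =>
    (klDensity (ν ℓ) (f ℓ) (L ℓ θ')).toReal - (klDensity (ν ℓ) (f ℓ) (L ℓ θ)).toReal with hd
  have hlim : ∑ ℓ : Sending comp, limitWeights A comp ℓ k * d ℓ =
      avgDivergence A comp ν f L k θ' - avgDivergence A comp ν f L k θ := by
    simp only [avgDivergence, hd, mul_sub, Finset.sum_sub_distrib]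
  -- For `j > n` the truncated subtraction gives `A ^ 0`, whose entries obey the same bound.
  have hnoise := ae_all_iff.2 fun ℓ : V => ae_tendsto_weighted_average_log_likelihood_ratio
    hf hL hξ hlaw hindep hKL (c := fun n j => (A ^ (n - j)) ℓ (k : V))
    (fun n j => hpow (n - j) ℓ) ℓ θ θ'
  filter_upwards [ae_likelihood_pos hL hξ hlaw hKL, hnoise] with ω hpos hω
  have hinit : Tendsto (fun n : ℕ =>
      (∑ ℓ, (A ^ n) ℓ (k : V) * (Real.log (μ₀ ℓ θ) - Real.log (μ₀ ℓ θ'))) / (n : ℝ))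
      atTop (𝓝 0) := by
    refine squeeze_zero_norm (fun n => ?_) (tendsto_const_div_atTop_nhds_zero_nat
      (∑ ℓ, |Real.log (μ₀ ℓ θ) - Real.log (μ₀ ℓ θ')|))
    rw [norm_div, Real.norm_natCast]
    refine div_le_div_of_nonneg_right ?_ (Nat.cast_nonneg n)
    refine (norm_sum_le _ _).trans (Finset.sum_le_sum fun ℓ _ => ?_)
    rw [norm_mul]
    exact mul_le_of_le_one_left (abs_nonneg _) (hpow n ℓ)
  have hmain := (hinit.add (tendsto_finsetSum Finset.univ fun ℓ _ => hω ℓ)).add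
    (tendsto_average_pow_mul hA s k d)
  rw [Finset.sum_const_zero, add_zero, zero_add, hlim] at hmain
  refine hmain.congr fun n => ?_
  rw [log_belief_sub hμ₀ hpos, ← Finset.sum_div, ← add_div, ← add_div, add_assoc,
    Finset.sum_comm, ← Finset.sum_add_distrib]
  congr 2
  refine Finset.sum_congr rfl fun j _ => ?_
  rw [← Finset.sum_add_distrib]
  exact Finset.sum_congr rfl fun ℓ _ => by ring

end LogRatioLimit

theorem theorem1 {V : Type*} [Fintype V] [DecidableEq V] {S R : ℕ}
    {Θ : Type*} [Fintype Θ]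
    {X : V → Type*} [∀ k, MeasurableSpace (X k)]
    {Ω : Type*} [MeasurableSpace Ω] (P : Measure Ω) [IsProbabilityMeasure P]
    -- the weakly connected network
    (A : Matrix V V ℝ) (comp : V → Fin S ⊕ Fin R) (hA : IsWeaklyConnected A comp)
    -- true densities and likelihoods, with respect to reference measures
    (ν : ∀ k, Measure (X k)) (f : ∀ k, X k → ℝ) (L : ∀ k, Θ → X k → ℝ)
    (hf : ∀ k, IsDensity (ν k) (f k)) (hL : ∀ k θ, IsDensity (ν k) (L k θ))
    -- data: agent `k` observes `ξ k i` at time `i + 1`; independent over time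
    (ξ : ∀ k, ℕ → Ω → X k) (hξ : ∀ k i, Measurable (ξ k i))
    (hlaw : ∀ k i, P.map (ξ k i) = law (ν k) (f k))
    (hindep : iIndepFun (fun (i : ℕ) (ω : Ω) (k : V) => ξ k i ω) P)
    -- finite divergences
    (hKL : ∀ k θ, klDensity (ν k) (f k) (L k θ) < ⊤)
    -- positive initial beliefs
    (μ₀ : V → Θ → ℝ) (hμ₀ : ∀ k θ, 0 < μ₀ k θ) (hμ₀_sum : ∀ k, ∑ θ, μ₀ k θ = 1)
    -- a receiving agent and the unique minimizer of its average divergence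
    (k : Receiving comp) (θstar : Θ)
    (hmin : ∀ θ, θ ≠ θstar →
      avgDivergence A comp ν f L k θstar < avgDivergence A comp ν f L k θ) :
    (∀ᵐ ω ∂P, Tendsto (fun i : ℕ => belief A L μ₀ (fun ℓ j => ξ ℓ j ω) i k θstar)
      atTop (𝓝 1)) ∧
    ∀ θ, θ ≠ θstar →
      ∀ᵐ ω ∂P, Tendsto
        (fun i : ℕ => Real.log (belief A L μ₀ (fun ℓ j => ξ ℓ j ω) i k θ) / (i : ℝ))
        atTop (𝓝 (avgDivergence A comp ν f L k θstar - avgDivergence A comp ν f L k θ)) := by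
  have : Nonempty Θ := ⟨θstar⟩
  have hall : ∀ᵐ ω ∂P, Tendsto (fun i : ℕ => belief A L μ₀ (fun ℓ j => ξ ℓ j ω) i k θstar)
      atTop (𝓝 1) ∧ ∀ θ, θ ≠ θstar → Tendsto
        (fun i : ℕ => Real.log (belief A L μ₀ (fun ℓ j => ξ ℓ j ω) i k θ) / (i : ℝ))
        atTop (𝓝 (avgDivergence A comp ν f L k θstar - avgDivergence A comp ν f L k θ)) := by
    have hratio : ∀ᵐ ω ∂P, ∀ θ, θ ≠ θstar → Tendsto (fun n : ℕ =>
        (Real.log (belief A L μ₀ (fun ℓ j => ξ ℓ j ω) n k θ) -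
          Real.log (belief A L μ₀ (fun ℓ j => ξ ℓ j ω) n k θstar)) / (n : ℝ)) atTop
        (𝓝 (avgDivergence A comp ν f L k θstar - avgDivergence A comp ν f L k θ)) := by
      refine ae_all_iff.2 fun θ => ?_
      rcases isEmpty_or_nonempty (Fin S) with hS | ⟨⟨s⟩⟩
      -- Without sending sub-networks all average divergences are empty sums, so a strict minimizer
      -- leaves no other hypothesis.
      · refine Eventually.of_forall fun ω hθ => absurd (hmin θ hθ) ?_
        have : IsEmpty (Sending comp) := ⟨fun ℓ => by
          obtain ⟨s, -⟩ := Sum.isLeft_iff.1 ℓ.2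
          exact hS.false s⟩
        simp [avgDivergence]
      · filter_upwards [ae_tendsto_log_belief_ratio hA s hf hL hξ hlaw hindep hKL hμ₀ k θ θstar]
          with ω hω _ using hω
    filter_upwards [hratio] with ω hω
    exact tendsto_of_log_ratio (fun n θ => belief_pos hμ₀ n k θ)
      (fun n => sum_belief hμ₀_sum n k) (fun θ hθ => sub_neg.2 (hmin θ hθ)) hω
  exact ⟨hall.mono fun ω h => h.1, fun θ hθ => hall.mono fun ω h => h.2 θ hθ⟩
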